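/- Let $r>0$, $T>0$ and $\theta\ge 0$. **Notation.** For $x\in L_2(\mathbf R;\mathbf C)$ let $X(i\omega)=\int_{-\infty}^{\infty}e^{-i\omega t}x(t)\,dt$ be its Fourier transform (in the $L_2$ sense). Let $\mathcal X(r)$ be the set of real valued $x\in L_2(\mathbf R)$ with $\int_{-\infty}^{\infty}e^{r|\omega|}|X(i\omega)|^2d\omega<\infty$, and let $\mathcal U(r)$ be the set of $x\in\mathcal X(r)$ for which this integral is at most $1$. Let $\mathcal H$ be the set of functions $h\in C^\infty(\mathbf R;\mathbf R)$ with $h(t)=0$ for $t\notin[-T,\theta]$. For $\tau>0$ let $\widehat{\mathcal H}(\tau)$ be the set of $g\in L_2(\mathbf R;\mathbf C)$ with $g(t)=0$ for $t\notin[0,\tau]$ whose Laplace transform $\int_0^\infty e^{-zt}g(t)\,dt$ belongs to $\mathbb H^2\cap\mathbb H^\infty$, where $\mathbb H^p$ is the Hardy space of holomorphic functions $F$ on $\{\operatorname{Re} z>0\}$ with $\sup_{s>0}\|F(s+i\,\cdot)\|_{L_p(\mathbf R)}<\infty$. **Theorem.** (i) There exist polynomials $\psi_d$ with complex coefficients,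 $d=1,2,\dots$, with $\psi_d$ of degree $d$, such that $$\int_{-\infty}^{\infty}|e^{iT\omega}-\psi_d(i\omega)|^2e^{-r|\omega|}\,d\omega\to0\quad\text{as } d\to\infty.\qquad(*)$$ (ii) Let $\psi_d(z)=\sum_{k=0}^d a_{dk}z^k$, $d=1,2,\dots$, be any sequence of polynomials with $(*)$, let $h\in\mathcal H$, and set $$\widehat h_d(t)=\sum_{k=0}^d a_{dk}\,\frac{d^kh}{dt^k}(t-T).$$ Then $\widehat h_d\in\widehat{\mathcal H}(T+\theta)$ for every $d\ge 1$. For $x\in\mathcal X(r)$ and $t\in\mathbf R$ put $$y(t)=\int_{t-\theta}^{t+T}h(t-s)x(s)\,ds,\qquad \widehat y_d(t)=\int_{t-T-\theta}^{t}\widehat h_d(t-s)x(s)\,ds .$$ Then $$\widehat y_d(t)=\sum_{k=0}^d a_{dk}\int_{t-T-\theta}^{t}\frac{d^kh}{dt^k}(t-s-T)\,x(s)\,ds ,$$ for each $x\in\mathcal X(r)$ one has $\sup_{t\in\mathbf R}|y(t)-\widehat y_d(t)|\to0$ as $d\to\infty$, and this convergence is uniform over $x\in\mathcal U(r)$. 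-/

import Mathlib

open MeasureTheory Filter Topology Polynomial
open scoped ENNReal FourierTransform

noncomputable section

namespace LimitedMemoryPredictors

/-- The Fourier transform `X(iω) = ∫ e^{-iωt} x(t) dt` of `x ∈ L₂(ℝ; ℂ)`, as a function of `ω`.
Mathlib's `𝓕` on `L₂` (the Plancherel extension) uses the kernel `e^{-2πiξt}`, whence the argument
`ξ = ω / (2π)`. It is determined up to almost everywhere equality. -/
def fourierL2 (x : Lp ℂ 2 (volume : Measure ℝ)) (ω : ℝ) : ℂ :=
  (𝓕 x : Lp ℂ 2 (volume : Measure ℝ)) (ω / (2 * Real.pi))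

/-- The squared weighted norm `‖u‖²_{L_{2,r}} = ∫ e^{r|ω|} |u(ω)|² dω`, with values in `[0, ∞]`. -/
def weightedSqNorm (r : ℝ) (u : ℝ → ℂ) : ℝ≥0∞ :=
  ∫⁻ ω : ℝ, ENNReal.ofReal (Real.exp (r * |ω|)) * ‖u ω‖ₑ ^ 2

/-- The class `𝒳(r)` of real valued processes `x ∈ L₂` with `‖X(i·)‖_{L_{2,r}} < ∞`. -/
def processClass (r : ℝ) : Set (Lp ℂ 2 (volume : Measure ℝ)) :=
  {x | (∀ᵐ t : ℝ, (x t).im = 0) ∧ weightedSqNorm r (fourierL2 x) < ∞}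

/-- The class `𝒰(r)` of the processes `x ∈ 𝒳(r)` with `‖X(i·)‖_{L_{2,r}} ≤ 1`. -/
def unitProcessClass (r : ℝ) : Set (Lp ℂ 2 (volume : Measure ℝ)) :=
  {x | x ∈ processClass r ∧ weightedSqNorm r (fourierL2 x) ≤ 1}

/-- The class of the anticausal kernels: smooth real functions vanishing outside `[-T, θ]`. -/
def targetKernels (θ T : ℝ) : Set (ℝ → ℝ) :=
  {h | ContDiff ℝ ((⊤ : ℕ∞) : WithTop ℕ∞) h ∧ ∀ t, t ∉ Set.Icc (-T) θ → h t = 0}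

/-- The Laplace transform `∫₀^∞ e^{-zt} f(t) dt`. -/
def laplaceTransform (f : ℝ → ℂ) (z : ℂ) : ℂ :=
  ∫ t in Set.Ioi (0 : ℝ), Complex.exp (-z * (t : ℂ)) * f t

/-- `F` belongs to the Hardy space `ℍ^p` of the right half-plane `Re z > 0`. -/
def MemHardy (p : ℝ≥0∞) (F : ℂ → ℂ) : Prop :=
  DifferentiableOn ℂ F {z : ℂ | 0 < z.re} ∧
    (⨆ (s : ℝ) (_ : 0 < s),
      eLpNorm (fun ω : ℝ => F ((s : ℂ) + Complex.I * (ω : ℂ))) p volume) < ∞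

/-- The class of the causal kernels with memory `τ`: square integrable functions vanishing outside
`[0, τ]` whose Laplace transform is in `ℍ² ∩ ℍ^∞`. -/
def predictingKernels (τ : ℝ) : Set (ℝ → ℂ) :=
  {g | MemLp g 2 volume ∧ (∀ t, t ∉ Set.Icc (0 : ℝ) τ → g t = 0) ∧
    MemHardy 2 (laplaceTransform g) ∧ MemHardy ∞ (laplaceTransform g)}

/-- The anticausal convolution to be predicted: `y(t) = ∫_{t-θ}^{t+T} h(t-s) x(s) ds`. -/
def target (θ T : ℝ) (h : ℝ → ℝ) (x : ℝ → ℂ) (t : ℝ) : ℂ :=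
  ∫ s in (t - θ)..(t + T), ((h (t - s) : ℝ) : ℂ) * x s

/-- The prediction with kernel `g` and memory `τ`: `ŷ(t) = ∫_{t-τ}^{t} g(t-s) x(s) ds`. -/
def prediction (τ : ℝ) (g : ℝ → ℂ) (x : ℝ → ℂ) (t : ℝ) : ℂ :=
  ∫ s in (t - τ)..t, g (t - s) * x s

/-- The kernel `ĥ_d(t) = ∑_{k=0}^d a_k h^{(k)}(t-T)`, where `a_k` are the coefficients of `P`. -/
def polyKernel (T : ℝ) (h : ℝ → ℝ) (d : ℕ) (P : ℂ[X]) (t : ℝ) : ℂ :=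
  ∑ k ∈ Finset.range (d + 1), P.coeff k * ((iteratedDeriv k h (t - T) : ℝ) : ℂ)

/-- `∫ |e^{iTω} - P(iω)|² e^{-r|ω|} dω`, that is, the square of the distance of `e^{iT·}` and
`P(i·)` in `L_{2,-r}`, with values in `[0, ∞]`. -/
def expApproxError (r T : ℝ) (P : ℂ[X]) : ℝ≥0∞ :=
  weightedSqNorm (-r)
    (fun ω : ℝ => Complex.exp (Complex.I * (T : ℂ) * (ω : ℂ)) - P.eval (Complex.I * (ω : ℂ)))

end LimitedMemoryPredictors

end

/-! For (i), the Taylor polynomials of `e^{iδω}` are dominated by `e^{δ|ω|}`, so they converge in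
the weight `e^{-r|ω|}` only under `2δ < r`. A long horizon is cut into `N` steps of length `δ =
T/N`. Each step trades one factor `e^{iδω}` for a polynomial, and the remaining exponential is
unimodular and costs nothing (`tendsto_weightedSqNorm_expTaylor`, `polyApproximable_eval_mul_exp`).
A small multiple of `z^d` then makes the degree exactly `d`.

For (ii), differentiation becomes multiplication by `iω` and the shift by `T` becomes `e^{-iTω}`.
Hence the transform of `h - ĥ_d` is `e^{-iTω} H(iω) (e^{iTω} - ψ_d(iω))`, with `H` bounded by the
`L₁` norm of `h`. Parseval and Cauchy–Schwarz with weights `e^{∓r|ω|/2}` bound the error by this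
norm times the distance in (*) times the weighted norm of `X` (`enorm_target_sub_prediction_le`).
The bound does not involve `t`, and involves `x` only through its weighted norm, which gives both
uniformities. The kernels are admissible because they are smooth and supported in `[0, T + θ]`. -/

namespace LimitedMemoryPredictors

/-! ### Polynomial approximation of `e^{iTω}` in the weighted space -/

section PolynomialDensity

lemma enorm_sq_le_two_mul_add (a b : ℂ) :
    ‖a‖ₑ ^ 2 ≤ 2 * ‖b‖ₑ ^ 2 + 2 * ‖a - b‖ₑ ^ 2 := by
  have h : ‖a‖ ^ 2 ≤ 2 * ‖b‖ ^ 2 + 2 * ‖a - b‖ ^ 2 := by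
    have h1 : ‖a‖ ≤ ‖b‖ + ‖a - b‖ := by simpa using norm_add_le b (a - b)
    nlinarith [sq_nonneg (‖b‖ - ‖a - b‖), norm_nonneg a, norm_nonneg b, norm_nonneg (a - b)]
  have h2 := ENNReal.ofReal_le_ofReal h
  rw [ENNReal.ofReal_add (by positivity) (by positivity), ENNReal.ofReal_mul (by norm_num),
    ENNReal.ofReal_mul (by norm_num), ENNReal.ofReal_pow (norm_nonneg _),
    ENNReal.ofReal_pow (norm_nonneg _), ENNReal.ofReal_pow (norm_nonneg _)] at h2
  simpa [ofReal_norm] using h2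

/-- Stands in for the triangle inequality: squared norms in `[0, ∞]` need neither roots nor
finiteness. -/
lemma weightedSqNorm_le_two_mul_add (r : ℝ) {u v : ℝ → ℂ} (hv : Measurable v) :
    weightedSqNorm r u ≤ 2 * weightedSqNorm r v + 2 * weightedSqNorm r (fun ω => u ω - v ω) := by
  unfold weightedSqNorm
  rw [← lintegral_const_mul' _ _ (by norm_num), ← lintegral_const_mul' _ _ (by norm_num),
    ← lintegral_add_left (by fun_prop)]
  refine lintegral_mono fun ω => ?_
  calc ENNReal.ofReal (Real.exp (r * |ω|)) * ‖u ω‖ₑ ^ 2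
      ≤ ENNReal.ofReal (Real.exp (r * |ω|)) * (2 * ‖v ω‖ₑ ^ 2 + 2 * ‖u ω - v ω‖ₑ ^ 2) := by
        gcongr; exact enorm_sq_le_two_mul_add _ _
    _ = _ := by ring

lemma weightedSqNorm_const_mul (r : ℝ) (c : ℂ) (u : ℝ → ℂ) :
    weightedSqNorm r (fun ω => c * u ω) = ‖c‖ₑ ^ 2 * weightedSqNorm r u := by
  unfold weightedSqNorm
  rw [← lintegral_const_mul' _ _ (by finiteness)]
  refine lintegral_congr fun ω => ?_
  rw [enorm_mul]; ring

lemma integrable_exp_neg_mul_abs {c : ℝ} (hc : 0 < c) :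
    Integrable fun ω : ℝ => Real.exp (-c * |ω|) := by
  have h1 : IntegrableOn (fun ω : ℝ => Real.exp (-c * |ω|)) (Set.Ioi 0) :=
    (integrableOn_exp_mul_Ioi (neg_neg_of_pos hc) 0).congr_fun
      (fun ω hω => by simp only [abs_of_pos (Set.mem_Ioi.1 hω)]) measurableSet_Ioi
  have h2 : IntegrableOn (fun ω : ℝ => Real.exp (-c * |ω|)) (Set.Iic 0) :=
    (integrableOn_exp_mul_Iic hc 0).congr_fun
      (fun ω hω => by simp only [abs_of_nonpos (Set.mem_Iic.1 hω)]; ring_nf) measurableSet_Iic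
  have := h2.union h1
  rwa [Set.Iic_union_Ioi, integrableOn_univ] at this

lemma exists_norm_eval_le_exp (P : ℂ[X]) {c : ℝ} (hc : 0 < c) :
    ∃ C : ℝ, 0 ≤ C ∧ ∀ ω : ℝ, ‖P.eval (Complex.I * (ω : ℂ))‖ ≤ C * Real.exp (c * |ω|) := by
  induction P using Polynomial.induction_on' with
  | add p q hp hq =>
    obtain ⟨A, hA, hA'⟩ := hp
    obtain ⟨B, hB, hB'⟩ := hq
    refine ⟨A + B, by positivity, fun ω => ?_⟩
    rw [eval_add, add_mul]
    exact (norm_add_le _ _).trans (add_le_add (hA' ω) (hB' ω))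
  | monomial n a =>
    refine ⟨‖a‖ * (n.factorial / c ^ n), by positivity, fun ω => ?_⟩
    have h := Real.pow_div_factorial_le_exp (c * |ω|) (by positivity) n
    rw [mul_pow, div_le_iff₀ (by positivity)] at h
    simp only [eval_monomial, norm_mul, norm_pow, Complex.norm_I, one_mul, Complex.norm_real,
      Real.norm_eq_abs, mul_assoc]
    gcongr
    rw [div_mul_eq_mul_div, le_div_iff₀ (by positivity)]
    linarith

lemma weightedSqNorm_eval_lt_top {r : ℝ} (hr : 0 < r) (P : ℂ[X]) :
    weightedSqNorm (-r) (fun ω : ℝ => P.eval (Complex.I * (ω : ℂ))) < ∞ := by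
  -- Squaring turns the rate `r/4` into `r/2`, leaving the integrable `e^{-r|ω|/2}`.
  obtain ⟨C, hC, h⟩ := exists_norm_eval_le_exp P (show 0 < r / 4 by positivity)
  refine lt_of_le_of_lt (lintegral_mono fun ω => ?_)
    (((integrable_exp_neg_mul_abs (show 0 < r / 2 by positivity)).const_mul (C ^ 2)).lintegral_lt_top)
  rw [← ofReal_norm, ← ENNReal.ofReal_pow (norm_nonneg _),
    ← ENNReal.ofReal_mul (Real.exp_nonneg _)]
  apply ENNReal.ofReal_le_ofReal
  calc Real.exp (-r * |ω|) * ‖P.eval (Complex.I * (ω : ℂ))‖ ^ 2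
      ≤ Real.exp (-r * |ω|) * (C * Real.exp (r / 4 * |ω|)) ^ 2 := by gcongr; exact h ω
    _ = C ^ 2 * (Real.exp (-r * |ω|) * (Real.exp (r / 4 * |ω|) * Real.exp (r / 4 * |ω|))) := by ring
    _ = C ^ 2 * Real.exp (-(r / 2) * |ω|) := by rw [← Real.exp_add, ← Real.exp_add]; ring_nf

/-- `u` is in the closure of the polynomials in `iω` with respect to `L_{2,-r}`. -/
def PolyApproximable (r : ℝ) (u : ℝ → ℂ) : Prop :=
  ∀ ε : ℝ≥0∞, 0 < ε →
    ∃ P : ℂ[X], weightedSqNorm (-r) (fun ω : ℝ => u ω - P.eval (Complex.I * (ω : ℂ))) < ε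

lemma polyApproximable_eval (r : ℝ) (P : ℂ[X]) :
    PolyApproximable r (fun ω : ℝ => P.eval (Complex.I * (ω : ℂ))) :=
  fun ε hε => ⟨P, by simpa [weightedSqNorm] using hε⟩

lemma PolyApproximable.of_approx {r : ℝ} {u : ℝ → ℂ} (hu : Measurable u)
    (h : ∀ ε : ℝ≥0∞, 0 < ε → ∃ v : ℝ → ℂ, Measurable v ∧ PolyApproximable r v ∧
      weightedSqNorm (-r) (fun ω => u ω - v ω) < ε) : PolyApproximable r u := by
  intro ε hε
  -- The quasi-triangle inequality doubles both errors, and `2(ε/4) + 2(ε/4) = ε`.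
  have hε' : 0 < ε / 2 / 2 := by simp [hε.ne']
  obtain ⟨v, hv, hvP, huv⟩ := h _ hε'
  obtain ⟨P, hP⟩ := hvP _ hε'
  refine ⟨P, lt_of_le_of_lt (weightedSqNorm_le_two_mul_add (-r) (hu.sub hv)) ?_⟩
  have e : ∀ ω, u ω - P.eval (Complex.I * (ω : ℂ)) - (u - v) ω
      = v ω - P.eval (Complex.I * (ω : ℂ)) := fun ω => by simp
  simp only [e]
  have two : ∀ a : ℝ≥0∞, 2 * (a / 2) = a := fun a => ENNReal.mul_div_cancel (by norm_num) (by norm_num)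
  calc 2 * weightedSqNorm (-r) (u - v) + 2 * weightedSqNorm (-r)
        (fun ω : ℝ => v ω - P.eval (Complex.I * (ω : ℂ)))
      < 2 * (ε / 2 / 2) + 2 * (ε / 2 / 2) := by
        have h2 : (2 : ℝ≥0∞) ≠ 0 := by norm_num
        have h2' : (2 : ℝ≥0∞) ≠ ∞ := by norm_num
        exact ENNReal.add_lt_add ((ENNReal.mul_lt_mul_iff_right h2 h2').2 huv)
          ((ENNReal.mul_lt_mul_iff_right h2 h2').2 hP)
    _ = ε := by rw [two, ENNReal.add_halves]

/-- The Taylor polynomials of `e^{δz}`. -/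
noncomputable def expTaylor (δ : ℝ) (n : ℕ) : ℂ[X] :=
  ∑ j ∈ Finset.range n, C ((δ : ℂ) ^ j / (j.factorial : ℂ)) * X ^ j

lemma eval_expTaylor (δ : ℝ) (n : ℕ) (z : ℂ) :
    (expTaylor δ n).eval z = ∑ j ∈ Finset.range n, ((δ : ℂ) * z) ^ j / (j.factorial : ℂ) := by
  simp only [expTaylor, eval_finsetSum, eval_mul, eval_C, eval_pow, eval_X, mul_pow]
  exact Finset.sum_congr rfl fun j _ => by ring

lemma tendsto_eval_expTaylor (δ : ℝ) (z : ℂ) :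
    Tendsto (fun n => (expTaylor δ n).eval z) atTop (𝓝 (Complex.exp (δ * z))) := by
  simp only [eval_expTaylor, Complex.exp_eq_exp_ℂ]
  exact (NormedSpace.expSeries_div_hasSum_exp (𝔸 := ℂ) ((δ : ℂ) * z)).tendsto_sum_nat

lemma norm_exp_sub_expTaylor_le (δ : ℝ) (n : ℕ) (z : ℂ) :
    ‖Complex.exp (δ * z) - (expTaylor δ n).eval z‖ ≤ Real.exp (|δ| * ‖z‖) := by
  rw [eval_expTaylor]
  refine (Complex.norm_exp_sub_sum_le_exp_norm_sub_sum _ _).trans ?_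
  rw [norm_mul, Complex.norm_real, Real.norm_eq_abs]
  exact sub_le_self _ (by positivity)

/-- Dominated convergence: the Taylor remainder is at most `e^{δ|ω|}`, its square uses up `2δ` of
the decay rate `r`, and `P` is absorbed by half of the gap `r - 2δ`. The phase `e^{isω}` drops out
of the modulus. -/
lemma tendsto_weightedSqNorm_expTaylor {r δ : ℝ} (hδ : 0 ≤ δ) (hδr : 2 * δ < r) (s : ℝ) (P : ℂ[X]) :
    Tendsto (fun n => weightedSqNorm (-r) (fun ω : ℝ =>
      P.eval (Complex.I * (ω : ℂ)) * Complex.exp (((s + δ : ℝ) : ℂ) * (Complex.I * (ω : ℂ))) -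
      (P * expTaylor δ n).eval (Complex.I * (ω : ℂ)) *
        Complex.exp ((s : ℂ) * (Complex.I * (ω : ℂ))))) atTop (𝓝 0) := by
  obtain ⟨C, hC, h⟩ := exists_norm_eval_le_exp P (show 0 < (r - 2 * δ) / 4 by linarith)
  have key : ∀ (n : ℕ) (ω : ℝ),
      ‖P.eval (Complex.I * (ω : ℂ)) * Complex.exp (((s + δ : ℝ) : ℂ) * (Complex.I * (ω : ℂ))) -
      (P * expTaylor δ n).eval (Complex.I * (ω : ℂ)) *
        Complex.exp ((s : ℂ) * (Complex.I * (ω : ℂ)))‖ =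
      ‖P.eval (Complex.I * (ω : ℂ))‖ *
        ‖Complex.exp (δ * (Complex.I * (ω : ℂ))) - (expTaylor δ n).eval (Complex.I * (ω : ℂ))‖ := by
    intro n ω
    have e : ‖Complex.exp ((s : ℂ) * (Complex.I * (ω : ℂ)))‖ = 1 := by
      rw [show (s : ℂ) * (Complex.I * (ω : ℂ)) = ((s * ω : ℝ) : ℂ) * Complex.I by push_cast; ring]
      exact Complex.norm_exp_ofReal_mul_I _
    rw [← mul_one (‖_‖ * ‖_‖), ← e, ← norm_mul, ← norm_mul]
    congr 1
    rw [eval_mul, Complex.ofReal_add, add_mul, Complex.exp_add]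
    ring
  have : (0 : ℝ≥0∞) = ∫⁻ _ : ℝ, 0 := by simp
  rw [this]
  refine tendsto_lintegral_of_dominated_convergence
    (fun ω => ENNReal.ofReal (C ^ 2 * Real.exp (-((r - 2 * δ) / 2) * |ω|))) (fun n => ?_)
    (fun n => .of_forall fun ω => ?_) ?_ (.of_forall fun ω => ?_)
  · have : ∀ Q : ℂ[X], Measurable fun ω : ℝ => Q.eval (Complex.I * (ω : ℂ)) := fun Q =>
      (Q.continuous.comp (by fun_prop)).measurable
    have h1 := this P
    have h2 := this (P * expTaylor δ n)
    fun_prop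
  · dsimp only
    rw [← ofReal_norm, ← ENNReal.ofReal_pow (norm_nonneg _),
      ← ENNReal.ofReal_mul (Real.exp_nonneg _), key]
    apply ENNReal.ofReal_le_ofReal
    have h3 := norm_exp_sub_expTaylor_le δ n (Complex.I * (ω : ℂ))
    simp only [norm_mul, Complex.norm_I, one_mul, Complex.norm_real, Real.norm_eq_abs,
      abs_of_nonneg hδ] at h3
    calc Real.exp (-r * |ω|) * (‖P.eval (Complex.I * (ω : ℂ))‖ *
          ‖Complex.exp (δ * (Complex.I * (ω : ℂ))) - (expTaylor δ n).eval (Complex.I * (ω : ℂ))‖) ^ 2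
        ≤ Real.exp (-r * |ω|) *
          ((C * Real.exp ((r - 2 * δ) / 4 * |ω|)) * Real.exp (δ * |ω|)) ^ 2 := by
          gcongr
          exact h ω
      _ = C ^ 2 * (Real.exp (-r * |ω|) * (Real.exp ((r - 2 * δ) / 4 * |ω|) *
          Real.exp ((r - 2 * δ) / 4 * |ω|) * (Real.exp (δ * |ω|) * Real.exp (δ * |ω|)))) := by ring
      _ = C ^ 2 * Real.exp (-((r - 2 * δ) / 2) * |ω|) := by
          simp only [← Real.exp_add]; ring_nf
  · exact (((integrable_exp_neg_mul_abs (show 0 < (r - 2 * δ) / 2 by linarith)).const_mul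
      (C ^ 2)).lintegral_lt_top).ne
  · have h4 : Tendsto (fun n => Complex.exp (δ * (Complex.I * (ω : ℂ))) -
        (expTaylor δ n).eval (Complex.I * (ω : ℂ))) atTop (𝓝 0) := by
      simpa using (tendsto_eval_expTaylor δ (Complex.I * (ω : ℂ))).const_sub
        (Complex.exp (δ * (Complex.I * (ω : ℂ))))
    have h5 : Tendsto (fun n => Real.exp (-r * |ω|) * (‖P.eval (Complex.I * (ω : ℂ))‖ *
        ‖Complex.exp (δ * (Complex.I * (ω : ℂ))) - (expTaylor δ n).eval (Complex.I * (ω : ℂ))‖) ^ 2)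
        atTop (𝓝 0) := by
      simpa using ((h4.norm.const_mul ‖P.eval (Complex.I * (ω : ℂ))‖).pow 2).const_mul
        (Real.exp (-r * |ω|))
    have h6 := ENNReal.tendsto_ofReal h5
    rw [ENNReal.ofReal_zero] at h6
    refine h6.congr fun n => ?_
    rw [← ofReal_norm, ← ENNReal.ofReal_pow (norm_nonneg _),
      ← ENNReal.ofReal_mul (Real.exp_nonneg _), key]

/-- The factor `P` makes the induction close: replacing one `e^{iδω}` by a Taylor polynomial changes
the polynomial in front, so the induction hypothesis must cover all of them. -/
lemma polyApproximable_eval_mul_exp {r : ℝ} (hr : 0 < r) {T : ℝ} (hT : 0 ≤ T) (P : ℂ[X]) :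
    PolyApproximable r (fun ω : ℝ => P.eval (Complex.I * (ω : ℂ)) *
      Complex.exp ((T : ℂ) * (Complex.I * (ω : ℂ)))) := by
  -- Chosen so that `δ = T/N` satisfies `2δ < r`.
  obtain ⟨N, hN⟩ := exists_nat_gt (2 * T / r)
  have hN0 : (0 : ℝ) < N := lt_of_le_of_lt (by positivity) hN
  set δ : ℝ := T / N with hδ
  have hδ0 : 0 ≤ δ := by positivity
  have hδr : 2 * δ < r := by
    rw [div_lt_iff₀ hr] at hN
    rw [hδ, ← mul_div_assoc, div_lt_iff₀ hN0]
    linarith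
  have step : ∀ (m : ℕ) (Q : ℂ[X]), PolyApproximable r (fun ω : ℝ => Q.eval (Complex.I * (ω : ℂ)) *
      Complex.exp (((m * δ : ℝ) : ℂ) * (Complex.I * (ω : ℂ)))) := by
    intro m
    induction m with
    | zero => intro Q; simpa using polyApproximable_eval r Q
    | succ m ih =>
      intro Q
      have hmeas : ∀ (R : ℂ[X]) (s : ℝ), Measurable fun ω : ℝ => R.eval (Complex.I * (ω : ℂ)) *
          Complex.exp ((s : ℂ) * (Complex.I * (ω : ℂ))) := fun R s =>
        ((R.continuous.comp (by fun_prop)).mul (by fun_prop)).measurable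
      refine PolyApproximable.of_approx (hmeas _ _) fun ε hε => ?_
      obtain ⟨n, hn⟩ := ((tendsto_weightedSqNorm_expTaylor hδ0 hδr (m * δ) Q).eventually_lt_const
        hε).exists
      refine ⟨_, hmeas _ _, ih (Q * expTaylor δ n), ?_⟩
      rw [show ((m + 1 : ℕ) : ℝ) * δ = m * δ + δ by push_cast; ring]
      exact hn
  have := step N P
  rwa [hδ, mul_div_cancel₀ _ hN0.ne'] at this

lemma polyApproximable_exp {r : ℝ} (hr : 0 < r) {T : ℝ} (hT : 0 ≤ T) :
    PolyApproximable r (fun ω : ℝ => Complex.exp (Complex.I * (T : ℂ) * (ω : ℂ))) := by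
  have := polyApproximable_eval_mul_exp hr hT 1
  simp only [eval_one, one_mul] at this
  refine (congrArg _ (funext fun ω => ?_)).mp this
  congr 1
  ring

/-- Add `c z^d` to a good approximant of degree below `d`. Since `z^d` has finite weighted norm, a
small `c ≠ 0` costs little. -/
lemma eventually_exists_natDegree_eq {r : ℝ} (hr : 0 < r) {u : ℝ → ℂ} (hu : Measurable u)
    (h : PolyApproximable r u) {ε : ℝ≥0∞} (hε : 0 < ε) :
    ∀ᶠ d in atTop, ∃ P : ℂ[X], P.natDegree = d ∧
      weightedSqNorm (-r) (fun ω : ℝ => u ω - P.eval (Complex.I * (ω : ℂ))) < ε := by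
  have hε' : 0 < ε / 2 / 2 := by simp [hε.ne']
  obtain ⟨Q, hQ⟩ := h _ hε'
  filter_upwards [eventually_gt_atTop Q.natDegree] with d hd
  have hM := weightedSqNorm_eval_lt_top hr (X ^ d : ℂ[X])
  set M := weightedSqNorm (-r) (fun ω : ℝ => (X ^ d : ℂ[X]).eval (Complex.I * (ω : ℂ)))
  have hlim : Tendsto (fun n : ℕ => ‖((1 / ((n : ℝ) + 1) : ℝ) : ℂ)‖ₑ ^ 2 * M) atTop (𝓝 0) := by
    have h0 : Tendsto (fun n : ℕ => ((1 / ((n : ℝ) + 1) : ℝ) : ℂ)) atTop (𝓝 0) := by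
      have := (Complex.continuous_ofReal.tendsto 0).comp tendsto_one_div_add_atTop_nhds_zero_nat
      simpa [Function.comp_def] using this
    have h1 : Tendsto (fun n : ℕ => ‖((1 / ((n : ℝ) + 1) : ℝ) : ℂ)‖ₑ ^ 2) atTop (𝓝 0) := by
      have := ((continuous_enorm.tendsto _).comp h0)
      have := (ENNReal.continuous_pow 2).tendsto _ |>.comp this
      simpa [Function.comp_def] using this
    have := ENNReal.Tendsto.mul_const h1 (Or.inr hM.ne)
    simpa using this
  obtain ⟨n, hn⟩ := (hlim.eventually_lt_const hε').exists
  set c : ℂ := ((1 / ((n : ℝ) + 1) : ℝ) : ℂ)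
  have hc : c ≠ 0 := by
    simp only [c, ne_eq, Complex.ofReal_eq_zero]
    positivity
  refine ⟨C c * X ^ d + Q, ?_, ?_⟩
  · rw [natDegree_add_eq_left_of_natDegree_lt] <;> rw [natDegree_C_mul_X_pow _ _ hc]
    exact hd
  · refine lt_of_le_of_lt (weightedSqNorm_le_two_mul_add (-r)
      (v := fun ω : ℝ => u ω - Q.eval (Complex.I * (ω : ℂ)))
      (hu.sub (Q.continuous.comp (by fun_prop)).measurable)) ?_
    have e : ∀ ω : ℝ, u ω - (C c * X ^ d + Q).eval (Complex.I * (ω : ℂ)) -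
        (u ω - Q.eval (Complex.I * (ω : ℂ))) = -c * (X ^ d : ℂ[X]).eval (Complex.I * (ω : ℂ)) := by
      intro ω; simp
    simp only [e]
    rw [weightedSqNorm_const_mul, enorm_neg]
    have two : ∀ a : ℝ≥0∞, 2 * (a / 2) = a :=
      fun a => ENNReal.mul_div_cancel (by norm_num) (by norm_num)
    have h2 : (2 : ℝ≥0∞) ≠ 0 := by norm_num
    have h2' : (2 : ℝ≥0∞) ≠ ∞ := by norm_num
    calc _ < 2 * (ε / 2 / 2) + 2 * (ε / 2 / 2) :=
          ENNReal.add_lt_add ((ENNReal.mul_lt_mul_iff_right h2 h2').2 hQ)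
            ((ENNReal.mul_lt_mul_iff_right h2 h2').2 hn)
      _ = ε := by rw [two, ENNReal.add_halves]

/-- Take for each `d` a polynomial of degree `d` whose error is within `1/(d+1)` of the infimum, so
that a single sequence serves every `ε`. -/
lemma PolyApproximable.exists_seq_natDegree_eq {r : ℝ} (hr : 0 < r) {u : ℝ → ℂ} (hu : Measurable u)
    (h : PolyApproximable r u) : ∃ ψ : ℕ → ℂ[X], (∀ d, (ψ d).natDegree = d) ∧
      Tendsto (fun d => weightedSqNorm (-r)
        (fun ω : ℝ => u ω - (ψ d).eval (Complex.I * (ω : ℂ)))) atTop (𝓝 0) := by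
  let err : ℂ[X] → ℝ≥0∞ := fun P =>
    weightedSqNorm (-r) (fun ω : ℝ => u ω - P.eval (Complex.I * (ω : ℂ)))
  have hex : ∀ d : ℕ, ∃ P : ℂ[X], P.natDegree = d ∧ ∀ Q : ℂ[X], Q.natDegree = d →
      err P ≤ err Q + ((d : ℝ≥0∞) + 1)⁻¹ := by
    intro d
    set E : ℝ≥0∞ := ⨅ (Q : ℂ[X]) (_ : Q.natDegree = d), err Q with hE
    -- If the infimum is infinite, every competitor has infinite error and any polynomial of degree
    -- `d` will do.
    by_cases hEt : E = ∞
    · refine ⟨X ^ d, natDegree_X_pow d, fun Q hQ => ?_⟩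
      have : E ≤ err Q := iInf₂_le Q hQ
      rw [hEt, top_le_iff] at this
      simp [this]
    · have hlt : E < E + ((d : ℝ≥0∞) + 1)⁻¹ :=
        ENNReal.lt_add_right hEt (by simp)
      conv_lhs at hlt => rw [hE]
      simp only [iInf_lt_iff] at hlt
      obtain ⟨P, hP, hlt⟩ := hlt
      exact ⟨P, hP, fun Q hQ => hlt.le.trans (by gcongr; exact iInf₂_le Q hQ)⟩
  choose ψ hψ hmin using hex
  refine ⟨ψ, hψ, ?_⟩
  rw [ENNReal.tendsto_nhds_zero]
  intro ε hε
  have hε' : 0 < ε / 2 := by simp [hε.ne']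
  have hinv : Tendsto (fun d : ℕ => ((d : ℝ≥0∞) + 1)⁻¹) atTop (𝓝 0) := by
    have := (tendsto_add_atTop_iff_nat 1).2 ENNReal.tendsto_inv_nat_nhds_zero
    simpa using this
  filter_upwards [eventually_exists_natDegree_eq hr hu h hε', hinv.eventually_lt_const hε']
    with d ⟨P, hP, hPe⟩ hd
  calc err (ψ d) ≤ err P + ((d : ℝ≥0∞) + 1)⁻¹ := hmin d P hP
    _ ≤ ε / 2 + ε / 2 := add_le_add hPe.le hd.le
    _ = ε := ENNReal.add_halves ε

end PolynomialDensity

/-! ### Smoothness and support of the predicting kernels -/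

section Kernels

lemma iteratedDeriv_eq_zero_of_support_subset {h : ℝ → ℝ} {a b : ℝ}
    (hh : ∀ t, t ∉ Set.Icc a b → h t = 0) (k : ℕ) {t : ℝ} (ht : t ∉ Set.Icc a b) :
    iteratedDeriv k h t = 0 := by
  have : h =ᶠ[𝓝 t] fun _ => 0 := by
    filter_upwards [isClosed_Icc.isOpen_compl.mem_nhds ht] with s hs using hh s hs
  rw [this.iteratedDeriv_eq]
  exact iteratedDeriv_fun_const_zero

lemma iteratedDeriv_ofReal {h : ℝ → ℝ} (hh : ContDiff ℝ ((⊤ : ℕ∞) : WithTop ℕ∞) h) (k : ℕ) :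
    iteratedDeriv k (fun t => (h t : ℂ)) = fun t => ((iteratedDeriv k h t : ℝ) : ℂ) := by
  induction k with
  | zero => simp
  | succ k ih =>
    rw [iteratedDeriv_succ, ih, iteratedDeriv_succ]
    ext t
    exact ((hh.differentiable_iteratedDeriv k (by exact_mod_cast WithTop.coe_lt_top _)
      t).hasDerivAt.ofReal_comp).deriv

lemma contDiff_iteratedDeriv {h : ℝ → ℝ} (hh : ContDiff ℝ ((⊤ : ℕ∞) : WithTop ℕ∞) h) (k : ℕ) :
    ContDiff ℝ ((⊤ : ℕ∞) : WithTop ℕ∞) (iteratedDeriv k h) := by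
  rw [iteratedDeriv_eq_iterate]
  exact hh.iterate_deriv k

variable {θ T : ℝ} {h : ℝ → ℝ}

lemma contDiff_polyKernel (hh : h ∈ targetKernels θ T) (d : ℕ) (P : ℂ[X]) :
    ContDiff ℝ ((⊤ : ℕ∞) : WithTop ℕ∞) (polyKernel T h d P) := by
  unfold polyKernel
  refine ContDiff.sum fun k _ => contDiff_const.mul ?_
  exact Complex.ofRealCLM.contDiff.comp
    ((contDiff_iteratedDeriv hh.1 k).comp (contDiff_id.sub contDiff_const))

lemma polyKernel_eq_zero (hh : h ∈ targetKernels θ T) (d : ℕ) (P : ℂ[X]) {t : ℝ}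
    (ht : t ∉ Set.Icc 0 (T + θ)) : polyKernel T h d P t = 0 := by
  refine Finset.sum_eq_zero fun k _ => ?_
  rw [iteratedDeriv_eq_zero_of_support_subset hh.2 k (t := t - T), Complex.ofReal_zero, mul_zero]
  contrapose! ht
  exact ⟨by linarith [ht.1], by linarith [ht.2]⟩

end Kernels

/-! ### Smooth kernels supported in `[0, τ]` have Laplace transforms in `ℍ² ∩ ℍ^∞` -/

section LaplaceTransform

variable {g : ℝ → ℂ} {τ : ℝ}

lemma laplaceTransform_eq_integral (hg : ∀ t, t ∉ Set.Icc 0 τ → g t = 0) (z : ℂ) :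
    laplaceTransform g z = ∫ t : ℝ, Complex.exp (-z * (t : ℂ)) * g t := by
  unfold laplaceTransform
  rw [← integral_Ici_eq_integral_Ioi]
  refine setIntegral_eq_integral_of_forall_compl_eq_zero fun t ht => ?_
  rw [hg t fun h => ht h.1, mul_zero]

lemma differentiable_integral_exp_mul (hg : Continuous g) (hs : HasCompactSupport g) :
    Differentiable ℂ fun z : ℂ => ∫ t : ℝ, Complex.exp (-z * (t : ℂ)) * g t := by
  intro z₀
  have hcont : ∀ z : ℂ, Continuous fun t : ℝ => Complex.exp (-z * (t : ℂ)) * g t :=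
    fun z => by fun_prop
  have hsupp : ∀ F : ℝ → ℂ, HasCompactSupport fun t : ℝ => F t * g t := fun F => hs.mul_left
  refine (hasDerivAt_integral_of_dominated_loc_of_deriv_le
    (F' := fun z t => -(t : ℂ) * Complex.exp (-z * (t : ℂ)) * g t)
    (bound := fun t => |t| * Real.exp ((‖z₀‖ + 1) * |t|) * ‖g t‖)
    (Metric.ball_mem_nhds z₀ one_pos) (.of_forall fun z => (hcont z).aestronglyMeasurable)
    ((hcont z₀).integrable_of_hasCompactSupport (hsupp _)) ?_ (.of_forall fun t z hz => ?_) ?_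
    (.of_forall fun t z _ => ?_)).2.differentiableAt
  · have : Continuous fun t : ℝ => -(t : ℂ) * Complex.exp (-z₀ * (t : ℂ)) * g t := by fun_prop
    exact this.aestronglyMeasurable
  · rw [norm_mul, norm_mul, norm_neg, Complex.norm_real, Real.norm_eq_abs]
    gcongr
    rw [Complex.norm_exp]
    apply Real.exp_le_exp.2
    have h1 : ‖z‖ ≤ ‖z₀‖ + 1 := by
      have h2 : ‖z - z₀‖ < 1 := by simpa [dist_eq_norm] using hz
      have h3 := norm_add_le (z - z₀) z₀
      rw [sub_add_cancel] at h3
      linarith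
    calc (-z * (t : ℂ)).re ≤ ‖-z * (t : ℂ)‖ := Complex.re_le_norm _
      _ = ‖z‖ * |t| := by rw [norm_mul, norm_neg, Complex.norm_real, Real.norm_eq_abs]
      _ ≤ (‖z₀‖ + 1) * |t| := by gcongr
  · refine Continuous.integrable_of_hasCompactSupport (by fun_prop) ?_
    exact hs.norm.mul_left
  · have h1 : HasDerivAt (fun z : ℂ => -z * (t : ℂ)) (-(t : ℂ)) z := by
      simpa using ((hasDerivAt_id z).neg.mul_const (t : ℂ))
    have := (h1.cexp).mul_const (g t)
    rwa [mul_comm (Complex.exp _) (-(t : ℂ))] at this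

lemma norm_exp_neg_mul_mul_le (hg : ∀ t, t ∉ Set.Icc 0 τ → g t = 0) {z : ℂ} (hz : 0 ≤ z.re) (t : ℝ) :
    ‖Complex.exp (-z * (t : ℂ)) * g t‖ ≤ ‖g t‖ := by
  by_cases ht : t ∈ Set.Icc 0 τ
  · rw [norm_mul, Complex.norm_exp]
    refine mul_le_of_le_one_left (norm_nonneg _) (Real.exp_le_one_iff.2 ?_)
    simp only [neg_mul, Complex.neg_re, Complex.mul_re, Complex.ofReal_re, Complex.ofReal_im,
      mul_zero, sub_zero, Left.neg_nonpos_iff]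
    exact mul_nonneg hz ht.1
  · simp [hg t ht]

lemma differentiable_laplaceTransform (hg : Continuous g) (h0 : ∀ t, t ∉ Set.Icc 0 τ → g t = 0) :
    Differentiable ℂ (laplaceTransform g) := by
  rw [funext (laplaceTransform_eq_integral h0)]
  exact differentiable_integral_exp_mul hg (HasCompactSupport.intro isCompact_Icc h0)

lemma memHardy_top_laplaceTransform (hg : Continuous g) (h0 : ∀ t, t ∉ Set.Icc 0 τ → g t = 0) :
    MemHardy ∞ (laplaceTransform g) := by
  refine ⟨(differentiable_laplaceTransform hg h0).differentiableOn, ?_⟩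
  have hint : Integrable g :=
    hg.integrable_of_hasCompactSupport (HasCompactSupport.intro isCompact_Icc h0)
  refine lt_of_le_of_lt (iSup₂_le fun s hs => ?_)
    (ENNReal.ofReal_lt_top (r := ∫ t, ‖g t‖))
  rw [eLpNorm_exponent_top]
  refine eLpNormEssSup_le_of_ae_bound (.of_forall fun ω => ?_)
  rw [laplaceTransform_eq_integral h0]
  exact norm_integral_le_of_norm_le hint.norm
    (.of_forall fun t => norm_exp_neg_mul_mul_le h0 (by simpa using hs.le) t)

lemma eLpNorm_fourier_two (f : SchwartzMap ℝ ℂ) :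
    eLpNorm (fun ξ => 𝓕 (f : ℝ → ℂ) ξ) 2 volume = eLpNorm f 2 volume := by
  have h := SchwartzMap.norm_fourier_toL2_eq f
  rw [SchwartzMap.norm_toLp, SchwartzMap.norm_toLp] at h
  have h1 : eLpNorm (𝓕 f : SchwartzMap ℝ ℂ) 2 volume ≠ ∞ := (SchwartzMap.memLp _ 2 volume).2.ne
  have h2 : eLpNorm f 2 volume ≠ ∞ := (SchwartzMap.memLp f 2 volume).2.ne
  rwa [ENNReal.toReal_eq_toReal_iff' h1 h2] at h

lemma laplaceTransform_eq_fourier (h0 : ∀ t, t ∉ Set.Icc 0 τ → g t = 0) (s ω : ℝ) :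
    laplaceTransform g ((s : ℂ) + Complex.I * (ω : ℂ)) =
      𝓕 (fun t : ℝ => Complex.exp (-(s : ℂ) * (t : ℂ)) * g t) (ω / (2 * Real.pi)) := by
  rw [laplaceTransform_eq_integral h0, Real.fourier_eq']
  refine integral_congr_ae (.of_forall fun t => ?_)
  dsimp only
  rw [smul_eq_mul, ← mul_assoc, ← Complex.exp_add]
  congr 2
  simp only [RCLike.inner_apply, conj_trivial]
  push_cast
  field_simp
  ring

lemma lintegral_comp_div_two_pi (f : ℝ → ℝ≥0∞) :
    ∫⁻ ω : ℝ, f (ω / (2 * Real.pi)) = ENNReal.ofReal (2 * Real.pi) * ∫⁻ ξ : ℝ, f ξ := by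
  have hpi : (0 : ℝ) < 2 * Real.pi := by positivity
  have h := Real.map_volume_mul_left (inv_ne_zero hpi.ne')
  have he : MeasurableEmbedding fun x : ℝ => (2 * Real.pi)⁻¹ * x :=
    (Homeomorph.mulLeft₀ _ (inv_ne_zero hpi.ne')).measurableEmbedding
  have := he.lintegral_map (μ := volume) f
  rw [h, lintegral_smul_measure, inv_inv, abs_of_pos hpi, smul_eq_mul] at this
  rw [this]
  simp only [div_eq_inv_mul]

/-- On the line `Re z = s` the Laplace transform is the Fourier transform of the Schwartz function
`e^{-st} g(t)`. Plancherel gives its norm, and the damping factor is at most `1` on the support of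
`g`, so the bound is uniform in `s > 0`. -/
lemma memHardy_two_laplaceTransform (hg : ContDiff ℝ ((⊤ : ℕ∞) : WithTop ℕ∞) g)
    (h0 : ∀ t, t ∉ Set.Icc 0 τ → g t = 0) : MemHardy 2 (laplaceTransform g) := by
  refine ⟨(differentiable_laplaceTransform hg.continuous h0).differentiableOn, ?_⟩
  have hgL : MemLp g 2 volume :=
    hg.continuous.memLp_of_hasCompactSupport (HasCompactSupport.intro isCompact_Icc h0)
  refine lt_of_le_of_lt (iSup₂_le fun s hs => ?_)
    (b := ENNReal.ofReal (2 * Real.pi) ^ (1 / 2 : ℝ) * eLpNorm g 2 volume)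
    (ENNReal.mul_lt_top (by finiteness) hgL.2)
  have hsmooth : ContDiff ℝ ((⊤ : ℕ∞) : WithTop ℕ∞)
      (fun t : ℝ => Complex.exp (-(s : ℂ) * (t : ℂ)) * g t) := by
    refine ContDiff.mul ?_ hg
    exact (contDiff_const.mul Complex.ofRealCLM.contDiff).cexp
  have hsupp : HasCompactSupport (fun t : ℝ => Complex.exp (-(s : ℂ) * (t : ℂ)) * g t) :=
    (HasCompactSupport.intro isCompact_Icc h0).mul_left
  simp only [laplaceTransform_eq_fourier h0]
  set φ := hsupp.toSchwartzMap hsmooth with hφ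
  have hφc : (fun t : ℝ => Complex.exp (-(s : ℂ) * (t : ℂ)) * g t) = φ := rfl
  calc eLpNorm (fun ω : ℝ => 𝓕 (fun t : ℝ => Complex.exp (-(s : ℂ) * (t : ℂ)) * g t)
        (ω / (2 * Real.pi))) 2 volume
      = ENNReal.ofReal (2 * Real.pi) ^ (1 / 2 : ℝ) * eLpNorm (fun ξ => 𝓕 (φ : ℝ → ℂ) ξ) 2 volume := by
        rw [eLpNorm_eq_lintegral_rpow_enorm_toReal (by norm_num) (by norm_num),
          eLpNorm_eq_lintegral_rpow_enorm_toReal (by norm_num) (by norm_num), hφc,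
          lintegral_comp_div_two_pi (fun ξ => ‖𝓕 (φ : ℝ → ℂ) ξ‖ₑ ^ (2 : ℝ≥0∞).toReal),
          ENNReal.mul_rpow_of_nonneg _ _ (by norm_num)]
        rfl
    _ = ENNReal.ofReal (2 * Real.pi) ^ (1 / 2 : ℝ) * eLpNorm φ 2 volume := by
        rw [eLpNorm_fourier_two]
    _ ≤ _ := by
        gcongr
        refine eLpNorm_mono fun t => ?_
        exact norm_exp_neg_mul_mul_le h0 (z := (s : ℂ)) (by simpa using hs.le) t

lemma mem_predictingKernels_of_contDiff (hg : ContDiff ℝ ((⊤ : ℕ∞) : WithTop ℕ∞) g)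
    (h0 : ∀ t, t ∉ Set.Icc 0 τ → g t = 0) : g ∈ predictingKernels τ :=
  ⟨hg.continuous.memLp_of_hasCompactSupport (HasCompactSupport.intro isCompact_Icc h0), h0,
    memHardy_two_laplaceTransform hg h0, memHardy_top_laplaceTransform hg.continuous h0⟩

end LaplaceTransform

/-! ### Frequency-domain bound for the prediction error -/

section ErrorEstimate

lemma fourier_comp_sub_right (f : ℝ → ℂ) (T ξ : ℝ) :
    𝓕 (fun t => f (t - T)) ξ = Complex.exp (((-2 * Real.pi * T * ξ : ℝ) : ℂ) * Complex.I) * 𝓕 f ξ := by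
  rw [Real.fourier_real_eq_integral_exp_smul, Real.fourier_real_eq_integral_exp_smul,
    ← integral_const_mul, ← integral_add_right_eq_self _ T]
  refine integral_congr_ae (.of_forall fun t => ?_)
  simp only [smul_eq_mul, add_sub_cancel_right]
  rw [← mul_assoc, ← Complex.exp_add]
  congr 2
  push_cast
  ring

lemma norm_fourier_conj_comp_const_sub (f : ℝ → ℂ) (t ξ : ℝ) :
    ‖𝓕 (fun s => (starRingEnd ℂ) (f (t - s))) ξ‖ = ‖𝓕 f ξ‖ := by
  have h : 𝓕 (fun s => (starRingEnd ℂ) (f (t - s))) ξ =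
      (starRingEnd ℂ) (Complex.exp (((2 * Real.pi * t * ξ : ℝ) : ℂ) * Complex.I) * 𝓕 f ξ) := by
    rw [Real.fourier_real_eq_integral_exp_smul, Real.fourier_real_eq_integral_exp_smul,
      ← integral_const_mul, ← integral_conj, ← integral_sub_left_eq_self _ volume t]
    refine integral_congr_ae (.of_forall fun s => ?_)
    simp only [smul_eq_mul, map_mul, sub_sub_cancel]
    rw [← mul_assoc, ← Complex.exp_conj, ← Complex.exp_conj, ← Complex.exp_add]
    congr 2
    simp only [map_mul, Complex.conj_I, Complex.conj_ofReal]
    push_cast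
    ring
  rw [h, RCLike.norm_conj, norm_mul, Complex.norm_exp_ofReal_mul_I, one_mul]

/-- The convolution at `t` is the inner product of `x` with the conjugate of `k(t - ·)`. By Parseval
it moves to the frequency side, where `t` enters only through a phase; hence a bound free of `t`. -/
lemma enorm_integral_comp_sub_mul_le {k : ℝ → ℂ} (hk : ContDiff ℝ ((⊤ : ℕ∞) : WithTop ℕ∞) k)
    (hs : HasCompactSupport k) (x : Lp ℂ 2 (volume : Measure ℝ)) (t : ℝ) :
    ‖∫ s, k (t - s) * x s‖ₑ ≤
      ∫⁻ ξ, ‖𝓕 k ξ‖ₑ * ‖(𝓕 x : Lp ℂ 2 (volume : Measure ℝ)) ξ‖ₑ := by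
  have hsmooth : ContDiff ℝ ((⊤ : ℕ∞) : WithTop ℕ∞) fun s => (starRingEnd ℂ) (k (t - s)) :=
    Complex.conjCLE.contDiff.comp (hk.comp (contDiff_const.sub contDiff_id))
  have hsupp : HasCompactSupport fun s => (starRingEnd ℂ) (k (t - s)) :=
    (hs.comp_homeomorph (Homeomorph.subLeft t)).comp_left (map_zero (starRingEnd ℂ))
  set φ := hsupp.toSchwartzMap hsmooth with hφ
  have hφc : (φ : ℝ → ℂ) = fun s => (starRingEnd ℂ) (k (t - s)) := rfl
  have h1 : ∫ s, k (t - s) * x s = inner ℂ (φ.toLp 2) x := by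
    rw [L2.inner_def]
    refine integral_congr_ae ?_
    filter_upwards [φ.coeFn_toLp 2] with s hs
    rw [hs, hφc, RCLike.inner_apply, RingHomCompTriple.comp_apply, RingHom.id_apply, mul_comm]
  rw [h1, ← Lp.inner_fourier_eq, SchwartzMap.toLp_fourier_eq, L2.inner_def]
  refine (enorm_integral_le_lintegral_enorm _).trans (lintegral_mono_ae ?_)
  filter_upwards [(𝓕 φ).coeFn_toLp 2] with ξ hξ
  rw [hξ, RCLike.inner_apply, enorm_mul, mul_comm, RCLike.enorm_conj]
  gcongr
  rw [SchwartzMap.fourier_coe, hφc, ← ofReal_norm, norm_fourier_conj_comp_const_sub, ofReal_norm]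

/-- Cauchy–Schwarz after inserting `1 = e^{-r|ω|/2} e^{r|ω|/2}`. -/
lemma lintegral_enorm_mul_le_weightedSqNorm (r : ℝ) {u v : ℝ → ℂ} (hu : Measurable u)
    (hv : Measurable v) :
    ∫⁻ ω, ‖u ω‖ₑ * ‖v ω‖ₑ ≤
      weightedSqNorm (-r) u ^ (1 / 2 : ℝ) * weightedSqNorm r v ^ (1 / 2 : ℝ) := by
  have hexp : ∀ (a : ℝ) (w : ℝ → ℂ),
      ∫⁻ ω : ℝ, (ENNReal.ofReal (Real.exp (a / 2 * |ω|)) * ‖w ω‖ₑ) ^ (2 : ℝ) =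
        weightedSqNorm a w := by
    intro a w
    refine lintegral_congr fun ω => ?_
    rw [ENNReal.rpow_two, mul_pow, ← ENNReal.ofReal_pow (Real.exp_nonneg _), ← Real.exp_nat_mul]
    congr 3
    push_cast
    ring
  have h := ENNReal.lintegral_mul_le_Lp_mul_Lq volume Real.HolderConjugate.two_two
    (f := fun ω : ℝ => ENNReal.ofReal (Real.exp (-r / 2 * |ω|)) * ‖u ω‖ₑ)
    (g := fun ω : ℝ => ENNReal.ofReal (Real.exp (r / 2 * |ω|)) * ‖v ω‖ₑ)
    (by fun_prop) (by fun_prop)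
  rw [hexp, hexp] at h
  refine le_trans (le_of_eq (lintegral_congr fun ω => ?_)) h
  have e : ENNReal.ofReal (Real.exp (-r / 2 * |ω|)) * ENNReal.ofReal (Real.exp (r / 2 * |ω|)) = 1 := by
    rw [← ENNReal.ofReal_mul (Real.exp_nonneg _), ← Real.exp_add,
      show -r / 2 * |ω| + r / 2 * |ω| = 0 by ring, Real.exp_zero, ENNReal.ofReal_one]
  rw [Pi.mul_apply, mul_mul_mul_comm, e, one_mul]

lemma measurable_fourierL2 (x : Lp ℂ 2 (volume : Measure ℝ)) : Measurable (fourierL2 x) :=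
  (Lp.stronglyMeasurable (𝓕 x : Lp ℂ 2 (volume : Measure ℝ))).measurable.comp (by fun_prop)

lemma intervalIntegral_eq_integral_of_eq_zero {F : ℝ → ℂ} {a b : ℝ} (hab : a ≤ b)
    (hF : ∀ s, s ∉ Set.Icc a b → F s = 0) : ∫ s in a..b, F s = ∫ s, F s := by
  rw [intervalIntegral.integral_of_le hab, ← integral_Icc_eq_integral_Ioc]
  exact setIntegral_eq_integral_of_forall_compl_eq_zero hF

lemma integrable_comp_sub_mul {f : ℝ → ℂ} (hf : Continuous f) (hs : HasCompactSupport f)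
    (x : Lp ℂ 2 (volume : Measure ℝ)) (t : ℝ) : Integrable fun s => f (t - s) * x s := by
  have h1 : MemLp (fun s => f (t - s)) 2 volume :=
    (hf.comp (continuous_sub_left t)).memLp_of_hasCompactSupport
      (hs.comp_homeomorph (Homeomorph.subLeft t))
  exact h1.integrable_mul (Lp.memLp x)

variable {θ T : ℝ} {h : ℝ → ℝ}

lemma contDiff_ofReal_comp (hh : ContDiff ℝ ((⊤ : ℕ∞) : WithTop ℕ∞) h) :
    ContDiff ℝ ((⊤ : ℕ∞) : WithTop ℕ∞) fun t => (h t : ℂ) :=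
  Complex.ofRealCLM.contDiff.comp hh

lemma hasCompactSupport_iteratedDeriv_ofReal (hh : h ∈ targetKernels θ T) (k : ℕ) :
    HasCompactSupport fun t => ((iteratedDeriv k h t : ℝ) : ℂ) :=
  HasCompactSupport.intro isCompact_Icc fun t ht => by
    rw [iteratedDeriv_eq_zero_of_support_subset hh.2 k ht, Complex.ofReal_zero]

lemma hasCompactSupport_ofReal (hh : h ∈ targetKernels θ T) :
    HasCompactSupport fun t => (h t : ℂ) :=
  HasCompactSupport.intro isCompact_Icc fun t ht => by rw [hh.2 t ht, Complex.ofReal_zero]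

lemma hasCompactSupport_polyKernel (hh : h ∈ targetKernels θ T) (d : ℕ) (P : ℂ[X]) :
    HasCompactSupport (polyKernel T h d P) :=
  HasCompactSupport.intro isCompact_Icc fun _ ht => polyKernel_eq_zero hh d P ht

lemma target_eq_integral (hT : 0 ≤ T) (hθ : 0 ≤ θ) (hh : h ∈ targetKernels θ T) (x : ℝ → ℂ) (t : ℝ) :
    target θ T h x t = ∫ s, (h (t - s) : ℂ) * x s := by
  refine intervalIntegral_eq_integral_of_eq_zero (by linarith) fun s hs => ?_
  rw [hh.2 (t - s), Complex.ofReal_zero, zero_mul]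
  contrapose! hs
  exact ⟨by linarith [hs.2], by linarith [hs.1]⟩

lemma prediction_polyKernel_eq_integral (hT : 0 ≤ T) (hθ : 0 ≤ θ) (hh : h ∈ targetKernels θ T)
    (d : ℕ) (P : ℂ[X]) (x : ℝ → ℂ) (t : ℝ) :
    prediction (T + θ) (polyKernel T h d P) x t = ∫ s, polyKernel T h d P (t - s) * x s := by
  refine intervalIntegral_eq_integral_of_eq_zero (by linarith) fun s hs => ?_
  rw [polyKernel_eq_zero hh, zero_mul]
  contrapose! hs
  exact ⟨by linarith [hs.2], by linarith [hs.1]⟩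

lemma prediction_polyKernel_eq_sum (hh : h ∈ targetKernels θ T) (d : ℕ) (P : ℂ[X])
    (x : Lp ℂ 2 (volume : Measure ℝ)) (t : ℝ) :
    prediction (T + θ) (polyKernel T h d P) x t =
      ∑ k ∈ Finset.range (d + 1), P.coeff k *
        ∫ s in (t - T - θ)..t, ((iteratedDeriv k h (t - s - T) : ℝ) : ℂ) * x s := by
  have hint : ∀ k : ℕ, Integrable fun s => ((iteratedDeriv k h (t - s - T) : ℝ) : ℂ) * x s := by
    intro k
    have := integrable_comp_sub_mul
      (contDiff_ofReal_comp (contDiff_iteratedDeriv hh.1 k)).continuous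
      (hasCompactSupport_iteratedDeriv_ofReal hh k) x (t - T)
    simpa only [sub_right_comm] using this
  unfold prediction polyKernel
  simp only [Finset.sum_mul, mul_assoc]
  rw [intervalIntegral.integral_finsetSum
    fun k _ => ((hint k).const_mul (P.coeff k)).intervalIntegrable, ← sub_sub]
  simp only [intervalIntegral.integral_const_mul]

lemma fourier_iteratedDeriv_ofReal (hh : h ∈ targetKernels θ T) (k : ℕ) (ξ : ℝ) :
    𝓕 (fun t => ((iteratedDeriv k h t : ℝ) : ℂ)) ξ =
      (2 * Real.pi * Complex.I * ξ) ^ k * 𝓕 (fun t => (h t : ℂ)) ξ := by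
  have hint : ∀ n : ℕ, (n : ℕ∞) ≤ ⊤ →
      Integrable (iteratedDeriv n fun t => (h t : ℂ)) volume := by
    intro n _
    rw [iteratedDeriv_ofReal hh.1]
    exact (contDiff_ofReal_comp (contDiff_iteratedDeriv hh.1 n)).continuous.integrable_of_hasCompactSupport
      (hasCompactSupport_iteratedDeriv_ofReal hh n)
  have := Real.fourier_iteratedDeriv (n := k) (contDiff_ofReal_comp hh.1) hint le_top
  rw [iteratedDeriv_ofReal hh.1] at this
  simp only [this, smul_eq_mul]

/-- The degree bound matters because `polyKernel` reads only the coefficients up to index `d`. -/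
lemma fourier_polyKernel (hh : h ∈ targetKernels θ T) {d : ℕ} {P : ℂ[X]} (hP : P.natDegree ≤ d)
    (ξ : ℝ) : 𝓕 (polyKernel T h d P) ξ =
      Complex.exp (((-2 * Real.pi * T * ξ : ℝ) : ℂ) * Complex.I) *
        P.eval (Complex.I * ((2 * Real.pi * ξ : ℝ) : ℂ)) * 𝓕 (fun t => (h t : ℂ)) ξ := by
  have hint : ∀ k : ℕ, Integrable fun t =>
      Complex.exp (((-2 * Real.pi * t * ξ : ℝ) : ℂ) * Complex.I) *
        ((iteratedDeriv k h (t - T) : ℝ) : ℂ) := by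
    intro k
    have h1 := (contDiff_ofReal_comp (contDiff_iteratedDeriv hh.1 k)).continuous
    have h2 := (hasCompactSupport_iteratedDeriv_ofReal hh k).comp_homeomorph (Homeomorph.subRight T)
    refine Continuous.integrable_of_hasCompactSupport ?_ h2.mul_left
    have := h1.comp (continuous_sub_right T)
    simp only [Function.comp_def] at this
    fun_prop
  have hsum : 𝓕 (polyKernel T h d P) ξ = ∑ k ∈ Finset.range (d + 1), P.coeff k *
      𝓕 (fun t => ((iteratedDeriv k h (t - T) : ℝ) : ℂ)) ξ := by
    simp only [Real.fourier_real_eq_integral_exp_smul, smul_eq_mul]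
    simp only [← integral_const_mul]
    rw [← integral_finsetSum _ fun k _ => (hint k).const_mul (P.coeff k)]
    refine integral_congr_ae (.of_forall fun t => ?_)
    simp only [polyKernel, Finset.mul_sum]
    exact Finset.sum_congr rfl fun k _ => by ring
  rw [hsum, eval_eq_sum_range' (Nat.lt_succ_of_le hP), Finset.mul_sum, Finset.sum_mul]
  refine Finset.sum_congr rfl fun k _ => ?_
  rw [fourier_comp_sub_right (fun t => ((iteratedDeriv k h t : ℝ) : ℂ)),
    fourier_iteratedDeriv_ofReal hh]
  rw [show Complex.I * ((2 * Real.pi * ξ : ℝ) : ℂ) = 2 * Real.pi * Complex.I * ξ by push_cast; ring]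
  ring

lemma norm_fourier_sub_polyKernel_le (hh : h ∈ targetKernels θ T) {d : ℕ} {P : ℂ[X]}
    (hP : P.natDegree ≤ d) (ω : ℝ) :
    ‖𝓕 (fun t => (h t : ℂ) - polyKernel T h d P t) (ω / (2 * Real.pi))‖ ≤
      (∫ t, ‖(h t : ℂ)‖) *
        ‖Complex.exp (Complex.I * (T : ℂ) * (ω : ℂ)) - P.eval (Complex.I * (ω : ℂ))‖ := by
  have hpi : (Real.pi : ℝ) ≠ 0 := Real.pi_ne_zero
  set ξ : ℝ := ω / (2 * Real.pi) with hξ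
  have hω : 2 * Real.pi * ξ = ω := by rw [hξ]; field_simp
  have hf : ∀ f : ℝ → ℂ, Continuous f → HasCompactSupport f → Integrable fun t =>
      Complex.exp (((-2 * Real.pi * t * ξ : ℝ) : ℂ) * Complex.I) * f t := by
    intro f hf hs
    exact Continuous.integrable_of_hasCompactSupport (by fun_prop) hs.mul_left
  have hsub : 𝓕 (fun t => (h t : ℂ) - polyKernel T h d P t) ξ =
      𝓕 (fun t => (h t : ℂ)) ξ - 𝓕 (polyKernel T h d P) ξ := by
    simp only [Real.fourier_real_eq_integral_exp_smul, smul_eq_mul, mul_sub]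
    exact integral_sub
      (hf _ (contDiff_ofReal_comp hh.1).continuous (hasCompactSupport_ofReal hh))
      (hf _ (contDiff_polyKernel hh d P).continuous (hasCompactSupport_polyKernel hh d P))
  have hnorm : ‖𝓕 (fun t => (h t : ℂ)) ξ‖ ≤ ∫ t, ‖(h t : ℂ)‖ := by
    rw [Real.fourier_real_eq_integral_exp_smul]
    refine (norm_integral_le_integral_norm _).trans_eq (integral_congr_ae (.of_forall fun t => ?_))
    dsimp only
    rw [norm_smul, Complex.norm_exp_ofReal_mul_I, one_mul]
  have hfac : 𝓕 (fun t => (h t : ℂ)) ξ - 𝓕 (polyKernel T h d P) ξ =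
      Complex.exp (((-T * ω : ℝ) : ℂ) * Complex.I) * (𝓕 (fun t => (h t : ℂ)) ξ *
        (Complex.exp (Complex.I * (T : ℂ) * (ω : ℂ)) - P.eval (Complex.I * (ω : ℂ)))) := by
    have he : Complex.exp (((-T * ω : ℝ) : ℂ) * Complex.I) *
        Complex.exp (Complex.I * (T : ℂ) * (ω : ℂ)) = 1 := by
      rw [← Complex.exp_add, ← Complex.exp_zero]
      congr 1
      push_cast
      ring
    rw [fourier_polyKernel hh hP, hω, show -2 * Real.pi * T * ξ = -T * ω by rw [← hω]; ring]
    linear_combination (-𝓕 (fun t => (h t : ℂ)) ξ) * he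
  rw [hsub, hfac, norm_mul, Complex.norm_exp_ofReal_mul_I, one_mul, norm_mul]
  gcongr

lemma enorm_target_sub_prediction_le (r : ℝ) (hT : 0 ≤ T) (hθ : 0 ≤ θ) (hh : h ∈ targetKernels θ T)
    {d : ℕ} {P : ℂ[X]} (hP : P.natDegree ≤ d) (x : Lp ℂ 2 (volume : Measure ℝ)) (t : ℝ) :
    ‖target θ T h x t - prediction (T + θ) (polyKernel T h d P) x t‖ₑ ≤
      ENNReal.ofReal (∫ t, ‖(h t : ℂ)‖) *
        (expApproxError r T P ^ (1 / 2 : ℝ) * weightedSqNorm r (fourierL2 x) ^ (1 / 2 : ℝ)) := by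
  have hh1 := contDiff_ofReal_comp hh.1
  have hh2 := hasCompactSupport_ofReal hh
  have hg1 := contDiff_polyKernel hh d P
  have hg2 := hasCompactSupport_polyKernel hh d P
  set k : ℝ → ℂ := fun t => (h t : ℂ) - polyKernel T h d P t with hk
  have hdiff : target θ T h x t - prediction (T + θ) (polyKernel T h d P) x t =
      ∫ s, k (t - s) * x s := by
    rw [target_eq_integral hT hθ hh, prediction_polyKernel_eq_integral hT hθ hh, ← integral_sub
      (integrable_comp_sub_mul hh1.continuous hh2 x t)
      (integrable_comp_sub_mul hg1.continuous hg2 x t)]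
    simp only [hk, sub_mul]
  -- Passing from `ξ` to `ω = 2πξ` produces a factor `1/(2π)`, which is simply bounded by `1`.
  have hpi : (1 : ℝ≥0∞) ≤ ENNReal.ofReal (2 * Real.pi) := by
    rw [ENNReal.one_le_ofReal]
    linarith [Real.pi_gt_three]
  rw [hdiff]
  calc ‖∫ s, k (t - s) * x s‖ₑ
      ≤ ∫⁻ ξ, ‖𝓕 k ξ‖ₑ * ‖(𝓕 x : Lp ℂ 2 (volume : Measure ℝ)) ξ‖ₑ :=
        enorm_integral_comp_sub_mul_le (hh1.sub hg1) (hh2.sub hg2) x t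
    _ ≤ ENNReal.ofReal (2 * Real.pi) *
          ∫⁻ ξ, ‖𝓕 k ξ‖ₑ * ‖(𝓕 x : Lp ℂ 2 (volume : Measure ℝ)) ξ‖ₑ :=
        le_mul_of_one_le_left zero_le hpi
    _ = ∫⁻ ω : ℝ, ‖𝓕 k (ω / (2 * Real.pi))‖ₑ * ‖fourierL2 x ω‖ₑ :=
        (lintegral_comp_div_two_pi _).symm
    _ ≤ ∫⁻ ω : ℝ, ENNReal.ofReal (∫ t, ‖(h t : ℂ)‖) *
          (‖Complex.exp (Complex.I * (T : ℂ) * (ω : ℂ)) - P.eval (Complex.I * (ω : ℂ))‖ₑ *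
            ‖fourierL2 x ω‖ₑ) := by
        refine lintegral_mono fun ω => ?_
        rw [← mul_assoc]
        gcongr
        rw [← ofReal_norm, ← ofReal_norm, ← ENNReal.ofReal_mul (by positivity)]
        exact ENNReal.ofReal_le_ofReal (norm_fourier_sub_polyKernel_le hh hP ω)
    _ = ENNReal.ofReal (∫ t, ‖(h t : ℂ)‖) * ∫⁻ ω : ℝ,
          ‖Complex.exp (Complex.I * (T : ℂ) * (ω : ℂ)) - P.eval (Complex.I * (ω : ℂ))‖ₑ *
            ‖fourierL2 x ω‖ₑ := lintegral_const_mul' _ _ ENNReal.ofReal_ne_top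
    _ ≤ _ := by
        gcongr
        refine lintegral_enorm_mul_le_weightedSqNorm r ?_ (measurable_fourierL2 x)
        exact (Continuous.sub (by fun_prop) (P.continuous.comp (by fun_prop))).measurable

end ErrorEstimate

end LimitedMemoryPredictors

open LimitedMemoryPredictors in
theorem theorem2 (r T θ : ℝ) (hr : 0 < r) (hT : 0 < T) (hθ : 0 ≤ θ) :
    (∃ ψ : ℕ → ℂ[X], (∀ d, 1 ≤ d → (ψ d).natDegree = d) ∧
      Tendsto (fun d => expApproxError r T (ψ d)) atTop (𝓝 0)) ∧
    (∀ ψ : ℕ → ℂ[X], (∀ d, 1 ≤ d → (ψ d).natDegree ≤ d) →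
      Tendsto (fun d => expApproxError r T (ψ d)) atTop (𝓝 0) →
      ∀ h ∈ targetKernels θ T,
        (∀ d, 1 ≤ d → polyKernel T h d (ψ d) ∈ predictingKernels (T + θ)) ∧
        (∀ d, 1 ≤ d → ∀ x ∈ processClass r, ∀ t : ℝ,
          prediction (T + θ) (polyKernel T h d (ψ d)) x t =
            ∑ k ∈ Finset.range (d + 1), (ψ d).coeff k *
              ∫ s in (t - T - θ)..t, ((iteratedDeriv k h (t - s - T) : ℝ) : ℂ) * x s) ∧
        (∀ x ∈ processClass r,
          Tendsto (fun d => ⨆ t : ℝ,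
            ‖target θ T h x t - prediction (T + θ) (polyKernel T h d (ψ d)) x t‖ₑ)
            atTop (𝓝 0)) ∧
        (∀ ε : ℝ, 0 < ε → ∃ N : ℕ, ∀ d, N ≤ d → ∀ x ∈ unitProcessClass r, ∀ t : ℝ,
          ‖target θ T h x t - prediction (T + θ) (polyKernel T h d (ψ d)) x t‖ ≤ ε)) := by
  refine ⟨?_, fun ψ hdeg hψ h hh => ?_⟩
  · obtain ⟨ψ, hψ, hlim⟩ := (polyApproximable_exp hr hT.le).exists_seq_natDegree_eq hr
      (by fun_prop : Continuous _).measurable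
    exact ⟨ψ, fun d _ => hψ d, hlim⟩
  have hbound : ∀ d, 1 ≤ d → ∀ (x : Lp ℂ 2 (volume : Measure ℝ)) (t : ℝ), _ := fun d hd x t =>
    enorm_target_sub_prediction_le r hT.le hθ hh (hdeg d hd) x t
  have hsqrt : Tendsto (fun d => expApproxError r T (ψ d) ^ (1 / 2 : ℝ)) atTop (𝓝 0) := by
    have := (ENNReal.continuous_rpow_const (y := 1 / 2)).tendsto 0 |>.comp hψ
    simpa [Function.comp_def] using this
  have hlim : ∀ M : ℝ≥0∞, M < ∞ → Tendsto (fun d => ENNReal.ofReal (∫ t, ‖(h t : ℂ)‖) *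
      (expApproxError r T (ψ d) ^ (1 / 2 : ℝ) * M ^ (1 / 2 : ℝ))) atTop (𝓝 0) := by
    intro M hM
    have h1 := ENNReal.Tendsto.mul_const hsqrt
      (Or.inr (ENNReal.rpow_ne_top_of_nonneg (by norm_num : (0 : ℝ) ≤ 1 / 2) hM.ne))
    have h2 := ENNReal.Tendsto.const_mul h1
      (Or.inr (ENNReal.ofReal_ne_top (r := ∫ t, ‖(h t : ℂ)‖)))
    simpa using h2
  refine ⟨fun d _ => mem_predictingKernels_of_contDiff (contDiff_polyKernel hh d _)
      fun t ht => polyKernel_eq_zero hh d _ ht,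
    fun d _ x _ t => prediction_polyKernel_eq_sum hh d _ x t, fun x hx => ?_, fun ε hε => ?_⟩
  · refine tendsto_of_tendsto_of_tendsto_of_le_of_le' tendsto_const_nhds
      (hlim _ hx.2) (.of_forall fun d => zero_le) ?_
    -- The degree hypothesis says nothing about `d = 0`, so the bound holds only from `d = 1` on.
    filter_upwards [eventually_ge_atTop 1] with d hd
    exact iSup_le fun t => hbound d hd x t
  -- On `𝒰(r)` the weighted norm is replaced by its bound `1`, so `N` depends on neither `x` nor
  -- `t`.
  · obtain ⟨N, hN⟩ := eventually_atTop.1 ((eventually_ge_atTop 1).and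
      ((hlim 1 ENNReal.one_lt_top).eventually_le_const (ENNReal.ofReal_pos.2 hε)))
    refine ⟨N, fun d hd x hx t => ?_⟩
    rw [← ENNReal.ofReal_le_ofReal_iff hε.le, ofReal_norm]
    refine (hbound d (hN d hd).1 x t).trans (le_trans ?_ (hN d hd).2)
    gcongr
    exact hx.2
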